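/- For a real number $x\ge 0$ let $\{x\}$ denote the least positive integer $n$ with $n\ge x$ (so $\{x\}=\lceil x\rceil$ for $x>0$, and $\{0\}=1$). A unital $C^*$-algebra $\mathcal E$ is said to be generated by $n$ mutually unitarily equivalent and almost mutually orthogonal projections if for every $\varepsilon>0$ there are projections $p_1,\dots,p_n\in\mathcal E$ such that (1) $p_1+\dots+p_n$ is invertible in $\mathcal E$; (2) the $C^*$-algebra $C^*(p_1,\dots,p_n)$ generated by $p_1,\dots,p_n$ is $\mathcal E$; (3) for all $i\ne j$, $p_i$ is unitarily equivalent to $p_j$ in $\mathcal E$ and $\|p_ip_j\|<\varepsilon$. Let $\mathrm{Pgen}(\mathcal E)\in\{2,3,\dots\}\cup\{\infty\}$ be the least integer $n\ge 2$ such that $\mathcal E$ is generated by $n$ mutually unitarily equivalent and almost mutually orthogonal projections, and $\infty$ if there is no such $n$. Let $\mathrm{M}_n(C(X))$ be the $C^*$-algebra of $n\times n$ matrices over the algebra $C(X)$ of continuous complex-valued functions on $X$. Corollary 3.5. Let $m\ge 0$ be an integer and let $X$ be a compact metric space of covering dimension $\dim X\le m$. (a) If $m\ge 1$ and $X$ can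 be (topologically) embedded into $\mathbb C^m$, then $\mathrm{Pgen}(\mathrm{M}_{3k}(C(X)))\le 3$, where $k=\{\sqrt{2m-1}\}$. (b) In general (with no embedding assumption), $\mathrm{Pgen}(\mathrm{M}_{3s}(C(X)))\le 3$, where $s=\{\sqrt{2m}\}$. -/

import Mathlib

open scoped ComplexOrder

/-- `X` has (Lebesgue) covering dimension at most `n`: every finite open cover of `X` has a finite
open refinement covering `X` such that no point lies in more than `n + 1` of its members. -/
def CoveringDimLE (X : Type*) [TopologicalSpace X] (n : ℕ) : Prop :=
  ∀ U : Set (Set X), U.Finite → (∀ u ∈ U, IsOpen u) → ⋃₀ U = Set.univ →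
    ∃ V : Set (Set X), V.Finite ∧ (∀ v ∈ V, IsOpen v) ∧ ⋃₀ V = Set.univ ∧
      (∀ v ∈ V, ∃ u ∈ U, v ⊆ u) ∧ ∀ x : X, {v ∈ V | x ∈ v}.encard ≤ n + 1

/-- `p` and `q` are unitarily equivalent in the unital C⋆-algebra `A`. -/
def UnitarilyEquivalent {A : Type*} [CStarAlgebra A] (p q : A) : Prop :=
  ∃ u ∈ unitary A, q = u * p * star u

/-- The C⋆-algebra `C⋆(S)` generated by a set `S` in `A`: the norm closure of the (not necessarily
unital) star subalgebra generated by `S`. -/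
noncomputable def cstarGenerated {A : Type*} [CStarAlgebra A] (S : Set A) : NonUnitalStarSubalgebra ℂ A :=
  (NonUnitalStarAlgebra.adjoin ℂ S).topologicalClosure

/-- The unital C⋆-algebra `A` is generated by `n` mutually unitarily equivalent and almost mutually
orthogonal projections. -/
def IsGeneratedByAlmostOrthogonalProjections (A : Type*) [CStarAlgebra A] (n : ℕ) : Prop :=
  ∀ ε : ℝ, 0 < ε → ∃ p : Fin n → A, (∀ i, IsStarProjection (p i)) ∧
    IsUnit (∑ i, p i) ∧
    cstarGenerated (Set.range p) = ⊤ ∧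
    ∀ i j, i ≠ j → UnitarilyEquivalent (p i) (p j) ∧ ‖p i * p j‖ < ε

/-- The least integer `k ≥ 2` such that `A` is generated by `k` mutually unitarily equivalent and
almost mutually orthogonal projections, and `∞` if there is no such `k`. -/
noncomputable def Pgen (A : Type*) [CStarAlgebra A] : ℕ∞ :=
  sInf {k : ℕ∞ | ∃ n : ℕ, k = n ∧ 2 ≤ n ∧ IsGeneratedByAlmostOrthogonalProjections A n}

/-- The least natural number `n` (natural numbers starting at `1`) with `x ≤ n`; it equals `⌈x⌉`
for every `x > 0`, and it is `1` at `x = 0`. -/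
noncomputable def leastNatGE (x : ℝ) : ℕ :=
  sInf {n : ℕ | 1 ≤ n ∧ x ≤ n}

/-!
The statement splits into three independent parts.

*Three projections from one generator.* Let `A` be a unital C⋆-algebra with a `3 × 3` system of
matrix units `E` that is generated by `E` and one element `H` of the `(0, 2)` corner. For small
`t > 0` the positive matrix `G` with the diagonal entries `1`, with `t` next to the diagonal and with
`t H` in the place `(0, 2)` is the Gram matrix of three projections `V * E i i * V`, `V = √G`, which
are close to the orthogonal projections `E i i`, hence almost orthogonal and unitarily equivalent.
Their sum is `G`, so the algebra they generate contains `V⁻¹`, hence the `E i i`, hence the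
entries of `G`, that is, everything
(`isGeneratedByAlmostOrthogonalProjections_of_matrixUnits`). So `M_{3k}(C(X)) = M_3(M_k(C(X)))` is
generated by three such projections as soon as `M_k(C(X))` is generated by one element.

*One generator of `M_k(C(X))`.* A pair of a real diagonal matrix and a hermitian matrix with positive
superdiagonal has `k + (k ^ 2 - (k - 1)) = k ^ 2 + 1` real parameters. If continuous functions
separating the points of `X` are used as these parameters, and the diagonal entries of the first
matrix are kept in disjoint intervals, then functional calculus yields all matrix units, and the
Stone–Weierstrass theorem applied to the `(0, 0)` corner yields the rest
(`CStarMatrix.exists_generator`).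

*Real coordinates.* It remains to find at most `k ^ 2 + 1` real functions separating the points of
`X`. If `X` lies in `ℂ ^ m`, there are `2 m ≤ k ^ 2 + 1` of them, since `k ^ 2 ≥ 2 m - 1`. If only
`dim X ≤ m` is known, the theorem of Menger and Nöbeling (`CoveringDimLE.exists_injective`) embeds
`X` into `ℝ ^ (2 m + 1)`, and `s ^ 2 ≥ 2 m`. Its proof is the classical one: by Baire's theorem it is
enough to see that the maps separating points at distance at least `η` are open and dense in
`C(X, ℝ ^ (2 m + 1))`, and barycentric maps into points in general position show density.
-/

/-! ### Square roots near the identity and unitary equivalence of nearby projections -/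

section UnitarilyEquivalent

variable {A : Type*} [CStarAlgebra A]

lemma UnitarilyEquivalent.symm {p q : A} (h : UnitarilyEquivalent p q) :
    UnitarilyEquivalent q p := by
  obtain ⟨u, hu, rfl⟩ := h
  refine ⟨star u, Unitary.star_mem hu, ?_⟩
  have h1 : star u * u = 1 := (Unitary.mem_iff.mp hu).1
  calc p = (star u * u) * p * (star u * u) := by simp [h1]
    _ = star u * (u * p * star u) * star (star u) := by simp only [star_star, mul_assoc]

lemma UnitarilyEquivalent.trans {p q r : A} (h : UnitarilyEquivalent p q)
    (h' : UnitarilyEquivalent q r) : UnitarilyEquivalent p r := by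
  obtain ⟨u, hu, rfl⟩ := h
  obtain ⟨v, hv, rfl⟩ := h'
  exact ⟨v * u, mul_mem hv hu, by simp only [star_mul, mul_assoc]⟩

lemma IsSelfAdjoint.abs_sub_one_le_of_mem_spectrum {G : A} (hG : IsSelfAdjoint G) {x : ℝ}
    (hx : x ∈ spectrum ℝ G) : |x - 1| ≤ ‖G - 1‖ := by
  have h1 : IsSelfAdjoint (G - 1) := hG.sub (IsSelfAdjoint.one A)
  rcases subsingleton_or_nontrivial A with hA | hA
  · simp [spectrum.of_subsingleton] at hx
  have h2 : x - 1 ∈ spectrum ℝ (G - 1) := by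
    have := spectrum.sub_singleton_eq G (1 : ℝ)
    rw [map_one] at this
    rw [← this]
    exact Set.sub_mem_sub hx rfl
  simpa using spectrum.norm_le_norm_of_mem h2

/-- A self-adjoint element near `1` has an invertible self-adjoint square root near `1`, whose
inverse lies in the C⋆-algebra generated by the element and commutes with whatever commutes with the
element. -/
lemma IsSelfAdjoint.exists_sqrt_of_norm_sub_one_lt {G : A} (hG : IsSelfAdjoint G)
    (h1 : ‖G - 1‖ < 1) :
    ∃ V W : A, IsSelfAdjoint V ∧ IsSelfAdjoint W ∧ V * V = G ∧ V * W = 1 ∧ W * V = 1 ∧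
      ‖V - 1‖ ≤ ‖G - 1‖ ∧ W ∈ StarAlgebra.elemental ℂ G ∧
      ∀ b, Commute G b → Commute W b := by
  have hpos : ∀ x ∈ spectrum ℝ G, 0 < x := fun x hx => by
    have := abs_lt.mp ((hG.abs_sub_one_le_of_mem_spectrum hx).trans_lt h1)
    linarith
  have hc : ContinuousOn Real.sqrt (spectrum ℝ G) := Real.continuous_sqrt.continuousOn
  have hci : ContinuousOn (fun x => (Real.sqrt x)⁻¹) (spectrum ℝ G) :=
    hc.inv₀ fun x hx => (Real.sqrt_pos.mpr (hpos x hx)).ne'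
  have hVW : cfc Real.sqrt G * cfc (fun x => (Real.sqrt x)⁻¹) G = 1 := by
    rw [← cfc_mul Real.sqrt (fun x => (Real.sqrt x)⁻¹) G hc hci, ← cfc_one ℝ G]
    refine cfc_congr fun x hx => ?_
    exact mul_inv_cancel₀ (Real.sqrt_pos.mpr (hpos x hx)).ne'
  have hWV : cfc (fun x => (Real.sqrt x)⁻¹) G * cfc Real.sqrt G = 1 :=
    (cfc_commute_cfc _ _ G).eq.trans hVW
  refine ⟨cfc Real.sqrt G, cfc (fun x => (Real.sqrt x)⁻¹) G, cfc_predicate _ _, cfc_predicate _ _,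
    ?_, hVW, hWV, ?_, ?_, fun b hb => hb.cfc_real _⟩
  · rw [← cfc_mul Real.sqrt Real.sqrt G hc hc]
    conv_rhs => rw [← cfc_id' ℝ G]
    exact cfc_congr fun x hx => Real.mul_self_sqrt (hpos x hx).le
  · rw [← cfc_one ℝ G, ← cfc_sub Real.sqrt 1 G hc (by fun_prop)]
    refine norm_cfc_le (norm_nonneg _) fun x hx => ?_
    rw [cfc_one ℝ G]
    refine le_trans ?_ (hG.abs_sub_one_le_of_mem_spectrum hx)
    -- `|√x - 1| ≤ |√x - 1| * (√x + 1) = |x - 1|`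
    have hs := Real.sqrt_nonneg x
    have : x - 1 = (√x - 1) * (√x + 1) := by
      have := Real.mul_self_sqrt (hpos x hx).le
      linarith
    rw [this, abs_mul, abs_of_pos (by linarith : 0 < √x + 1), Pi.one_apply, Real.norm_eq_abs]
    nlinarith [abs_nonneg (√x - 1)]
  · rw [cfc_real_eq_complex]; exact cfc_mem_elemental _ _

/-- Nearby projections `p` and `q` are unitarily equivalent: `s = p + q - 1` satisfies
`s * p = q * s` and `s ^ 2 = 1 - (p - q) ^ 2`, and the unitary part of `s` conjugates `p` to `q`. -/
lemma IsStarProjection.unitarilyEquivalent_of_norm_sub_lt {p q : A} (hp : IsStarProjection p)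
    (hq : IsStarProjection q) (h : ‖p - q‖ < 1) : UnitarilyEquivalent p q := by
  have hpp : p * p = p := hp.isIdempotentElem
  have hqq : q * q = q := hq.isIdempotentElem
  obtain ⟨s, hs⟩ : ∃ s, s = p + q - 1 := ⟨_, rfl⟩
  have hssa : IsSelfAdjoint s := by
    rw [hs]; exact (hp.isSelfAdjoint.add hq.isSelfAdjoint).sub (IsSelfAdjoint.one A)
  have hsp : s * p = q * s := by
    rw [hs]; simp only [add_mul, sub_mul, mul_add, mul_sub, hpp, hqq, one_mul, mul_one]; abel
  have hps : p * s = s * q := by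
    rw [hs]; simp only [add_mul, sub_mul, mul_add, mul_sub, hpp, hqq, one_mul, mul_one]; abel
  have hss : s * s - 1 = - ((p - q) * (p - q)) := by
    rw [hs]; simp only [add_mul, sub_mul, mul_add, mul_sub, hpp, hqq, one_mul, mul_one]; abel
  have hG : IsSelfAdjoint (s * s) := by simp [IsSelfAdjoint, hssa.star_eq]
  have hn : ‖s * s - 1‖ < 1 := by
    rw [hss, norm_neg]
    exact (norm_mul_le _ _).trans_lt (mul_lt_one_of_nonneg_of_lt_one_left (norm_nonneg _) h h.le)
  obtain ⟨V, W, -, hW, hV2, hVW, hWV, -, -, hcomm⟩ := hG.exists_sqrt_of_norm_sub_one_lt hn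
  have hWs : W * s = s * W := hcomm s (by simp [Commute, SemiconjBy, mul_assoc])
  have hWp : W * p = p * W := hcomm p (by
    simp only [Commute, SemiconjBy]
    rw [mul_assoc, hsp, ← mul_assoc, ← hps, mul_assoc])
  have hone : s * s * W * W = 1 := by
    rw [← hV2, mul_assoc V, hVW, mul_one, hVW]
  have hstar : star (s * W) = s * W := by rw [star_mul, hW.star_eq, hssa.star_eq, hWs]
  have huu : s * W * (s * W) = 1 := by
    conv_lhs => rw [mul_assoc, ← mul_assoc W, hWs, ← mul_assoc, ← mul_assoc]
    exact hone
  refine ⟨s * W, ?_, ?_⟩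
  · rw [Unitary.mem_iff, hstar]; exact ⟨huu, huu⟩
  · rw [hstar, mul_assoc s W p, hWp, ← mul_assoc s p W, hsp, mul_assoc q s W, mul_assoc q, huu,
      mul_one]

end UnitarilyEquivalent

/-! ### Three projections generating a C⋆-algebra with a `3 × 3` system of matrix units -/

section Closed

variable {A : Type*} [CStarAlgebra A]

/-- A closed non-unital star subalgebra containing an element at distance less than `1` from `1`
contains `1`. -/
lemma NonUnitalStarSubalgebra.one_mem_of_norm_one_sub_lt (B : NonUnitalStarSubalgebra ℂ A)
    (hB : IsClosed (B : Set A)) {G : A} (hG : G ∈ B) (h : ‖1 - G‖ < 1) : (1 : A) ∈ B := by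
  have hmem : ∀ n : ℕ, 1 - (1 - G) ^ n ∈ B := by
    intro n
    induction n with
    | zero => simp
    | succ n ih =>
      have : 1 - (1 - G) ^ (n + 1) = (1 - (1 - G) ^ n) + (G - (1 - (1 - G) ^ n) * G) := by
        rw [pow_succ]; noncomm_ring
      rw [this]
      exact add_mem ih (sub_mem hG (mul_mem ih hG))
  have hlim : Filter.Tendsto (fun n : ℕ => 1 - (1 - G) ^ n) Filter.atTop (nhds 1) := by
    simpa using (tendsto_pow_atTop_nhds_zero_of_norm_lt_one h).const_sub 1
  exact hB.mem_of_tendsto hlim (Filter.Eventually.of_forall hmem)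

end Closed

section MatrixUnits

variable {A : Type*} [CStarAlgebra A] {E : Fin 3 → Fin 3 → A}

lemma isStarProjection_matrixUnit (hmul : ∀ a b c d, E a b * E c d = if b = c then E a d else 0)
    (hstar : ∀ a b, star (E a b) = E b a) (i : Fin 3) : IsStarProjection (E i i) :=
  ⟨by simp [IsIdempotentElem, hmul], hstar i i⟩

/-- Distinct diagonal matrix units are conjugate under the unitary swapping them. -/
lemma unitarilyEquivalent_matrixUnit
    (hmul : ∀ a b c d, E a b * E c d = if b = c then E a d else 0)
    (hstar : ∀ a b, star (E a b) = E b a) {i j : Fin 3} (hij : i ≠ j) :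
    UnitarilyEquivalent (E i i) (E j j) := by
  obtain ⟨u, hu⟩ : ∃ u, u = 1 - E i i - E j j + E i j + E j i := ⟨_, rfl⟩
  have hs : star u = u := by
    rw [hu]; simp only [star_add, star_sub, hstar, star_one]; abel
  have huu : u * u = 1 := by
    rw [hu]
    simp only [add_mul, sub_mul, mul_add, mul_sub, hmul, one_mul, mul_one, hij, hij.symm, if_true,
      if_false]
    abel
  refine ⟨u, ?_, ?_⟩
  · rw [Unitary.mem_iff, hs]; exact ⟨huu, huu⟩
  · rw [hs, hu]
    simp only [add_mul, sub_mul, mul_add, mul_sub, hmul, one_mul, mul_one, hij, hij.symm, if_true,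
      if_false]
    abel

/-- Let `E` be a `3 × 3` system of matrix units which, together with an element `H` of the `(0, 2)`
corner, generates `A`. A small perturbation `G = 1 + t K` of the identity, whose entries are
`t` in the places `(0, 1)` and `(1, 2)` and `t H` in the place `(0, 2)`, is the Gram matrix of three
almost orthogonal projections `V * E i i * V`, `V = √G`, and these generate `A`: their sum is `G`,
so `V⁻¹` belongs to the algebra they generate, and hence so do `E i i` and
`E i i * G * E j j`. -/
theorem isGeneratedByAlmostOrthogonalProjections_of_matrixUnits
    (hmul : ∀ a b c d, E a b * E c d = if b = c then E a d else 0)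
    (hstar : ∀ a b, star (E a b) = E b a) (hone : ∑ a, E a a = 1)
    {H : A} (hH0 : E 0 0 * H = H) (hH2 : H * E 2 2 = H)
    (hgen : ∀ B : StarSubalgebra ℂ A, IsClosed (B : Set A) → (∀ a b, E a b ∈ B) → H ∈ B → B = ⊤) :
    IsGeneratedByAlmostOrthogonalProjections A 3 := by
  intro ε hε
  obtain ⟨K, hK⟩ : ∃ K, K = E 0 1 + E 1 0 + E 1 2 + E 2 1 + H + star H := ⟨_, rfl⟩
  obtain ⟨t, ht0, ht1, htε⟩ : ∃ t : ℝ, 0 < t ∧ t * ‖K‖ < 1 / 4 ∧ t * ‖K‖ * 4 < ε := by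
    have hp : 0 < ‖K‖ + 1 := by positivity
    have hm : 0 < min (1 / 4) (ε / 4) := by positivity
    refine ⟨min (1 / 4) (ε / 4) / (‖K‖ + 1), by positivity, ?_⟩
    have : min (1 / 4) (ε / 4) / (‖K‖ + 1) * ‖K‖ < min (1 / 4) (ε / 4) := by
      rw [div_mul_eq_mul_div, div_lt_iff₀ hp]
      nlinarith
    have h1 := min_le_left (1 / 4) (ε / 4)
    have h2 := min_le_right (1 / 4) (ε / 4)
    constructor <;> linarith
  have hKsa : star K = K := by
    rw [hK]; simp only [star_add, hstar, star_star]; abel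
  obtain ⟨G, hGdef⟩ : ∃ G, G = 1 + (t : ℂ) • K := ⟨_, rfl⟩
  have hG : IsSelfAdjoint G := by
    simp [IsSelfAdjoint, hGdef, hKsa]
  have hGn : ‖G - 1‖ ≤ t * ‖K‖ := by
    rw [hGdef, add_sub_cancel_left, norm_smul]
    simp [abs_of_pos ht0]
  have hGn1 : ‖G - 1‖ < 1 := by linarith
  obtain ⟨V, W, hV, -, hVV, hVW, hWV, hVn, hWmem, -⟩ :=
    hG.exists_sqrt_of_norm_sub_one_lt hGn1
  have hEproj := isStarProjection_matrixUnit hmul hstar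
  have hEn : ∀ i, ‖E i i‖ ≤ 1 := fun i => (hEproj i).norm_le
  -- the diagonal entries of `G` are those of the identity, the others are those of `t K`
  have hH0' : ∀ i, i ≠ 0 → E i i * H = 0 := fun i hi => by
    rw [← hH0, ← mul_assoc, hmul, if_neg hi, zero_mul]
  have hH2' : ∀ i, i ≠ 2 → H * E i i = 0 := fun i hi => by
    rw [← hH2, mul_assoc, hmul, if_neg hi.symm, mul_zero]
  have hsH0 : ∀ i, i ≠ 0 → star H * E i i = 0 := fun i hi => by
    rw [← star_star (E i i), hstar, ← star_mul, hH0' i hi, star_zero]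
  have hsH2 : ∀ i, i ≠ 2 → E i i * star H = 0 := fun i hi => by
    rw [← star_star (E i i), hstar, ← star_mul, hH2' i hi, star_zero]
  have hdiagK : ∀ i, E i i * K * E i i = 0 := by
    intro i
    have e1 : E i i * H * E i i = 0 := by
      by_cases hi : i = 0
      · rw [mul_assoc, hH2' i (by rw [hi]; decide), mul_zero]
      · rw [hH0' i hi, zero_mul]
    have e2 : E i i * star H * E i i = 0 := by
      by_cases hi : i = 0
      · rw [hsH2 i (by rw [hi]; decide), zero_mul]
      · rw [mul_assoc, hsH0 i hi, mul_zero]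
    rw [hK]
    simp only [mul_add, add_mul, e1, e2]
    fin_cases i <;> simp [hmul]
  have hdiag : ∀ i, E i i * G * E i i = E i i := fun i => by
    rw [hGdef, mul_add, add_mul, mul_one, mul_smul_comm, smul_mul_assoc, hdiagK, smul_zero,
      add_zero, hmul, if_pos rfl]
  have hoff : ∀ i j, i ≠ j → E i i * G * E j j = (t : ℂ) • (E i i * K * E j j) := fun i j hij => by
    rw [hGdef, mul_add, add_mul, mul_one, mul_smul_comm, smul_mul_assoc, hmul, if_neg hij,
      zero_add]
  have hVle : ‖V‖ ≤ 5 / 4 ∨ Subsingleton A := by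
    rcases subsingleton_or_nontrivial A with h | h
    · exact Or.inr h
    · left
      calc ‖V‖ = ‖(V - 1) + 1‖ := by simp
        _ ≤ ‖V - 1‖ + ‖(1 : A)‖ := norm_add_le _ _
        _ ≤ 5 / 4 := by rw [CStarRing.norm_one]; linarith
  have hVle : ‖V‖ ≤ 5 / 4 := by
    rcases hVle with h | h
    · exact h
    · rw [Subsingleton.elim V 0, norm_zero]; norm_num
  have hproj : ∀ i, IsStarProjection (V * E i i * V) := fun i => by
    refine ⟨?_, ?_⟩
    · calc V * E i i * V * (V * E i i * V) = V * (E i i * (V * V) * E i i) * V := by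
            simp only [mul_assoc]
        _ = V * E i i * V := by rw [hVV, hdiag]
    · simp [IsSelfAdjoint, hV.star_eq, hstar, mul_assoc]
  have hsum : ∑ i, V * E i i * V = G := by
    rw [← Finset.sum_mul, ← Finset.mul_sum, hone, mul_one, hVV]
  have hclose : ∀ i, UnitarilyEquivalent (V * E i i * V) (E i i) := fun i => by
    refine (hproj i).unitarilyEquivalent_of_norm_sub_lt (hEproj i) ?_
    have : V * E i i * V - E i i = (V - 1) * E i i * V + E i i * (V - 1) := by noncomm_ring
    rw [this]
    have e1 : ‖(V - 1) * E i i * V‖ ≤ 1 / 4 * 1 * (5 / 4) :=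
      (norm_mul_le _ _).trans (mul_le_mul ((norm_mul_le _ _).trans
        (mul_le_mul (by linarith) (hEn i) (norm_nonneg _) (by norm_num))) hVle (norm_nonneg _)
        (by norm_num))
    have e2 : ‖E i i * (V - 1)‖ ≤ 1 * (1 / 4) :=
      (norm_mul_le _ _).trans (mul_le_mul (hEn i) (by linarith) (norm_nonneg _) (by norm_num))
    linarith [norm_add_le ((V - 1) * E i i * V) (E i i * (V - 1))]
  refine ⟨fun i => V * E i i * V, hproj, ?_, ?_, fun i j hij => ⟨?_, ?_⟩⟩
  · rw [hsum, ← hVV]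
    have : IsUnit V := ⟨⟨V, W, hVW, hWV⟩, rfl⟩
    exact this.mul this
  · obtain ⟨B₀, hB₀⟩ : ∃ B₀, B₀ = cstarGenerated (Set.range fun i => V * E i i * V) := ⟨_, rfl⟩
    rw [← hB₀]
    have hcl : IsClosed (B₀ : Set A) := by
      rw [hB₀]; exact NonUnitalStarSubalgebra.isClosed_topologicalClosure _
    have hp : ∀ i, V * E i i * V ∈ B₀ := fun i => by
      rw [hB₀]
      exact NonUnitalStarSubalgebra.le_topologicalClosure _
        (NonUnitalStarAlgebra.subset_adjoin ℂ _ ⟨i, rfl⟩)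
    have hGB : G ∈ B₀ := by rw [← hsum]; exact sum_mem fun i _ => hp i
    have h1B : (1 : A) ∈ B₀ :=
      B₀.one_mem_of_norm_one_sub_lt hcl hGB (by rw [norm_sub_rev]; exact hGn1)
    obtain ⟨B, hB⟩ : ∃ B : StarSubalgebra ℂ A, ∀ x, x ∈ B ↔ x ∈ B₀ :=
      ⟨B₀.toStarSubalgebra h1B, fun x => Iff.rfl⟩
    have hBcl : IsClosed (B : Set A) := by
      have : (B : Set A) = B₀ := Set.ext hB
      rw [this]; exact hcl
    have hle : StarAlgebra.elemental ℂ G ≤ B :=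
      StarAlgebra.elemental.le_of_mem hBcl ((hB G).mpr hGB)
    have hWB : W ∈ B := hle hWmem
    have hE : ∀ i, E i i ∈ B := fun i => by
      have : E i i = W * (V * E i i * V) * W := by
        calc E i i = (W * V) * E i i * (V * W) := by rw [hWV, hVW, one_mul, mul_one]
          _ = _ := by simp only [mul_assoc]
      rw [this]
      exact mul_mem (mul_mem hWB ((hB _).mpr (hp i))) hWB
    have hKB : ∀ i j, i ≠ j → E i i * K * E j j ∈ B := fun i j hij => by
      have : E i i * K * E j j = (t : ℂ)⁻¹ • (E i i * G * E j j) := by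
        rw [hoff i j hij, smul_smul, inv_mul_cancel₀ (by exact_mod_cast ht0.ne'), one_smul]
      rw [this]
      exact B.smul_mem (mul_mem (mul_mem (hE i) (hle (StarAlgebra.elemental.self_mem ℂ G))) (hE j))
        _
    have h01 : E 0 1 ∈ B := by
      convert hKB 0 1 (by decide) using 1
      rw [hK]
      simp only [mul_add, add_mul, hsH2 0 (by decide), zero_mul, mul_assoc,
        hH2' 1 (by decide), mul_zero]
      simp [hmul]
    have h12 : E 1 2 ∈ B := by
      convert hKB 1 2 (by decide) using 1
      rw [hK]
      simp only [mul_add, add_mul, hsH2 1 (by decide), zero_mul, hH0' 1 (by decide)]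
      simp [hmul]
    have hHB : H ∈ B := by
      convert hKB 0 2 (by decide) using 1
      rw [hK]
      simp only [mul_add, add_mul, hsH2 0 (by decide), zero_mul, hH0, hH2]
      simp [hmul]
    have h02 : E 0 2 ∈ B := by
      have := mul_mem h01 h12
      rwa [hmul, if_pos rfl] at this
    have hEall : ∀ a b, E a b ∈ B := by
      have hs : ∀ a b, E a b ∈ B → E b a ∈ B := fun a b h => by rw [← hstar]; exact star_mem h
      intro a b
      fin_cases a <;> fin_cases b
      exacts [hE 0, h01, h02, hs _ _ h01, hE 1, h12, hs _ _ h02, hs _ _ h12, hE 2]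
    have htop := hgen B hBcl hEall hHB
    refine SetLike.ext fun x => ?_
    rw [← hB x, htop]
    simp
  · exact (hclose i).trans ((unitarilyEquivalent_matrixUnit hmul hstar hij).trans (hclose j).symm)
  · have : V * E i i * V * (V * E j j * V) = (t : ℂ) • (V * (E i i * K * E j j) * V) := by
      calc V * E i i * V * (V * E j j * V) = V * (E i i * (V * V) * E j j) * V := by
            simp only [mul_assoc]
        _ = _ := by rw [hVV, hoff i j hij, mul_smul_comm, smul_mul_assoc]
    simp only [this, norm_smul, Complex.norm_real, Real.norm_eq_abs, abs_of_pos ht0]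
    have e1 : ‖E i i * K * E j j‖ ≤ 1 * ‖K‖ * 1 :=
      (norm_mul_le _ _).trans (mul_le_mul ((norm_mul_le _ _).trans
        (mul_le_mul_of_nonneg_right (hEn i) (norm_nonneg _))) (hEn j) (norm_nonneg _)
        (by positivity))
    have e2 : ‖V * (E i i * K * E j j) * V‖ ≤ 5 / 4 * (1 * ‖K‖ * 1) * (5 / 4) :=
      (norm_mul_le _ _).trans (mul_le_mul ((norm_mul_le _ _).trans
        (mul_le_mul hVle e1 (norm_nonneg _) (by norm_num))) hVle (norm_nonneg _)
        (by positivity))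
    have := mul_le_mul_of_nonneg_left e2 ht0.le
    nlinarith [norm_nonneg K, mul_nonneg ht0.le (norm_nonneg K)]

end MatrixUnits

/-! ### Generating `M_k(C(X))` by one element -/

namespace ContinuousMap

variable {Y : Type*} [TopologicalSpace Y]

/-- A real-valued continuous function, as a complex-valued one. -/
def toComplex (f : C(Y, ℝ)) : C(Y, ℂ) := ⟨fun y => (f y : ℂ), by fun_prop⟩

@[simp] lemma toComplex_apply (f : C(Y, ℝ)) (y : Y) : f.toComplex y = (f y : ℂ) := rfl

@[simp] lemma star_toComplex (f : C(Y, ℝ)) : star f.toComplex = f.toComplex := by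
  ext y; simp

variable [CompactSpace Y]

/-- A closed star subalgebra of `C(Y, ℂ)` is stable under composing its real-valued elements with
continuous functions. -/
lemma toComplex_comp_mem {S : StarSubalgebra ℂ C(Y, ℂ)} (hS : IsClosed (S : Set C(Y, ℂ)))
    {f : C(Y, ℝ)} (hf : f.toComplex ∈ S) (F : C(ℝ, ℝ)) : (F.comp f).toComplex ∈ S := by
  let S' : Subalgebra ℝ C(Y, ℝ) :=
    { carrier := {φ | φ.toComplex ∈ S}
      mul_mem' := fun {a b} ha hb => by
        have : (a * b).toComplex = a.toComplex * b.toComplex := by ext; simp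
        simpa only [Set.mem_ofPred_eq, this] using mul_mem ha hb
      add_mem' := fun {a b} ha hb => by
        have : (a + b).toComplex = a.toComplex + b.toComplex := by ext; simp
        simpa only [Set.mem_ofPred_eq, this] using add_mem ha hb
      algebraMap_mem' := fun r => by
        have : (algebraMap ℝ C(Y, ℝ) r).toComplex = algebraMap ℂ C(Y, ℂ) r := by ext; simp
        simpa only [Set.mem_ofPred_eq, this] using S.algebraMap_mem (r : ℂ) }
  have hcl : IsClosed (S' : Set C(Y, ℝ)) := by
    have hcont : Continuous (toComplex : C(Y, ℝ) → C(Y, ℂ)) :=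
      (⟨Complex.ofReal, Complex.continuous_ofReal⟩ : C(ℝ, ℂ)).continuous_postcomp
    exact hS.preimage hcont
  have h := comp_attachBound_mem_closure S' ⟨f, hf⟩ (F.restrict _)
  exact Subalgebra.topologicalClosure_minimal le_rfl hcl h

end ContinuousMap

namespace CStarMatrix

variable {X : Type*} [TopologicalSpace X] [CompactSpace X] {n : Type*} [DecidableEq n]

/-- The matrix with the only nonzero entry `φ`, in the place `(i, j)`. -/
def single {R : Type*} [Zero R] (i j : n) (φ : R) : CStarMatrix n n R :=
  ofMatrix (Matrix.single i j φ)

section Ring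

variable {R : Type*} [Ring R]

lemma single_apply (i j : n) (φ : R) (a b : n) :
    single i j φ a b = if i = a ∧ j = b then φ else 0 := rfl

lemma single_add (i j : n) (φ ψ : R) : single i j (φ + ψ) = single i j φ + single i j ψ :=
  Matrix.single_add i j φ ψ

lemma single_mul_single [Fintype n] (i j l : n) (φ ψ : R) :
    single i j φ * single j l ψ = single i l (φ * ψ) :=
  Matrix.single_mul_single_same φ i j l ψ

lemma single_mul_mul_single [Fintype n] (i j : n) (a : CStarMatrix n n R) :
    single i i 1 * a * single j j 1 = single i j (a i j) := by
  refine (Matrix.single_mul_mul_single (n := n) i i j j (1 : R) a 1).trans ?_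
  rw [one_mul, mul_one]; rfl

lemma star_single [StarRing R] (i j : n) (φ : R) : star (single i j φ) = single j i (star φ) :=
  Matrix.conjTranspose_single i j φ

lemma eq_sum_single [Fintype n] (a : CStarMatrix n n R) : a = ∑ i, ∑ j, single i j (a i j) :=
  Matrix.matrix_eq_sum_single a

end Ring

lemma continuous_single (i j : n) :
    Continuous (single i j : C(X, ℂ) → CStarMatrix n n C(X, ℂ)) := by
  refine continuous_pi fun a => continuous_pi fun b => ?_
  simp only [single_apply]
  split_ifs
  · exact continuous_id
  · exact continuous_const

variable [Fintype n]

/-- For a star subalgebra `B` of `M_n(C(X))` containing the diagonal matrix unit in the place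
`(i, i)`, the functions `φ` such that `φ` times this matrix unit is in `B`. -/
def diagonalEntries (B : StarSubalgebra ℂ (CStarMatrix n n C(X, ℂ))) (i : n)
    (h : single i i 1 ∈ B) : StarSubalgebra ℂ C(X, ℂ) where
  carrier := {φ | single i i φ ∈ B}
  mul_mem' {φ ψ} hφ hψ := by
    have := mul_mem (show single i i φ ∈ B from hφ) (show single i i ψ ∈ B from hψ)
    rwa [single_mul_single] at this
  add_mem' {φ ψ} hφ hψ := by
    have := add_mem (show single i i φ ∈ B from hφ) (show single i i ψ ∈ B from hψ)
    rwa [← single_add] at this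
  algebraMap_mem' r := by
    have := B.smul_mem h r
    have e : r • single i i (1 : C(X, ℂ)) = single i i (algebraMap ℂ C(X, ℂ) r) := by
      rw [Algebra.algebraMap_eq_smul_one]
      exact Matrix.smul_single r i i (1 : C(X, ℂ))
    rwa [e] at this
  star_mem' {φ} hφ := by
    have := star_mem (show single i i φ ∈ B from hφ)
    rwa [star_single] at this

lemma isClosed_diagonalEntries {B : StarSubalgebra ℂ (CStarMatrix n n C(X, ℂ))}
    (hB : IsClosed (B : Set (CStarMatrix n n C(X, ℂ)))) (i : n) (h : single i i 1 ∈ B) :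
    IsClosed (diagonalEntries B i h : Set C(X, ℂ)) :=
  hB.preimage (continuous_single i i)

/-- The diagonal matrix with the entries `φ (i, ·)`. -/
noncomputable def diagonalHom [TopologicalSpace n] [DiscreteTopology n] :
    C(n × X, ℂ) →⋆ₐ[ℂ] CStarMatrix n n C(X, ℂ) where
  toFun φ := ofMatrix (Matrix.diagonal fun i => φ.comp ⟨fun x => (i, x), by fun_prop⟩)
  map_one' := by
    exact Matrix.diagonal_one
  map_mul' φ ψ := (Matrix.diagonal_mul_diagonal
    (fun i => φ.comp ⟨fun x => (i, x), by fun_prop⟩)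
    (fun i => ψ.comp ⟨fun x => (i, x), by fun_prop⟩)).symm
  map_zero' := Matrix.diagonal_zero
  map_add' φ ψ := (Matrix.diagonal_add
    (fun i => φ.comp ⟨fun x => (i, x), by fun_prop⟩)
    (fun i => ψ.comp ⟨fun x => (i, x), by fun_prop⟩)).symm
  commutes' r := by
    exact (Matrix.algebraMap_eq_diagonal r).symm
  map_star' φ :=
    (Matrix.diagonal_conjTranspose fun i => φ.comp ⟨fun x => (i, x), by fun_prop⟩).symm

omit [CompactSpace X] in
lemma diagonalHom_apply [TopologicalSpace n] [DiscreteTopology n] (φ : C(n × X, ℂ)) (i j : n) :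
    diagonalHom φ i j = if i = j then φ.comp ⟨fun x => (i, x), by fun_prop⟩ else 0 := by
  exact Matrix.diagonal_apply _ _ _

lemma continuous_diagonalHom [TopologicalSpace n] [DiscreteTopology n] :
    Continuous (diagonalHom : C(n × X, ℂ) → CStarMatrix n n C(X, ℂ)) := by
  refine continuous_pi fun a => continuous_pi fun b => ?_
  simp only [diagonalHom_apply]
  split_ifs
  · exact ContinuousMap.continuous_precomp _
  · exact continuous_const

/-- If the diagonal entries of a real diagonal matrix take their values in disjoint intervals, then
the diagonal matrix units are continuous functions of it. -/
lemma single_one_mem {k : ℕ} {B : StarSubalgebra ℂ (CStarMatrix (Fin k) (Fin k) C(X, ℂ))}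
    (hB : IsClosed (B : Set (CStarMatrix (Fin k) (Fin k) C(X, ℂ)))) {l : Fin k → C(X, ℝ)}
    (hl : ∀ i x, l i x ∈ Set.Icc (0 : ℝ) 1)
    (h : ofMatrix (Matrix.diagonal fun i : Fin k => (3 * (i : ℂ)) • (1 : C(X, ℂ)) + (l i).toComplex)
      ∈ B) (i : Fin k) : single i i 1 ∈ B := by
  let S : StarSubalgebra ℂ C(Fin k × X, ℂ) := B.comap diagonalHom
  have hS : IsClosed (S : Set C(Fin k × X, ℂ)) := hB.preimage continuous_diagonalHom
  let L : C(Fin k × X, ℝ) := ⟨fun y => 3 * (y.1 : ℝ) + l y.1 y.2, by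
    rw [continuous_prod_of_discrete_left]
    intro j
    fun_prop⟩
  have hL : L.toComplex ∈ S := by
    change diagonalHom L.toComplex ∈ B
    convert h using 1
    ext a b x
    rw [diagonalHom_apply, ofMatrix_apply, Matrix.diagonal_apply]
    split_ifs
    · simp [L]
    · rfl
  let F : C(ℝ, ℝ) := ⟨fun t => max 0 (min 1 (2 - |t - (3 * (i : ℝ) + 1 / 2)|)), by fun_prop⟩
  have hF : diagonalHom (F.comp L).toComplex ∈ B := ContinuousMap.toComplex_comp_mem hS hL F
  convert hF using 1
  ext a b x
  rw [diagonalHom_apply, single_apply]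
  by_cases hab : a = b
  · subst hab
    obtain ⟨h0, h1⟩ := hl a x
    by_cases hia : i = a
    · subst hia
      have : |l i x - 1 / 2| ≤ 1 / 2 := abs_le.mpr ⟨by linarith, by linarith⟩
      have e : F (L (i, x)) = 1 := by
        simp only [F, L, ContinuousMap.coe_mk]
        rw [add_sub_add_left_eq_sub, min_eq_left (by linarith), max_eq_right zero_le_one]
      simp [e]
    · have : (5 : ℝ) / 2 ≤ |3 * (a : ℝ) + l a x - (3 * (i : ℝ) + 1 / 2)| := by
        rcases lt_or_gt_of_ne hia with hlt | hlt
        · have : (i : ℝ) + 1 ≤ a := by exact_mod_cast Nat.succ_le_of_lt hlt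
          exact le_trans (by linarith) (le_abs_self _)
        · have : (a : ℝ) + 1 ≤ i := by exact_mod_cast Nat.succ_le_of_lt hlt
          exact le_trans (by linarith) (neg_le_abs _)
      have e : F (L (a, x)) = 0 := by
        simp only [F, L, ContinuousMap.coe_mk]
        rw [max_eq_left (le_trans (min_le_right _ _) (by linarith))]
      simp [e, hia]
  · have : ¬ (i = a ∧ i = b) := fun h => hab (h.1.symm.trans h.2)
    simp [hab, this]

/-- A closed star subalgebra containing the diagonal matrix units and `1 + φ` in the place `(i, j)`,
where `φ ≥ 0`, contains the matrix unit of that place: `(1 + φ)⁻¹` is a continuous function of the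
`(i, i)` entry `(1 + φ) ^ 2` of an element. -/
lemma single_one_mem_of_single_mem {B : StarSubalgebra ℂ (CStarMatrix n n C(X, ℂ))}
    (hB : IsClosed (B : Set (CStarMatrix n n C(X, ℂ)))) {i j : n} (hi : single i i 1 ∈ B)
    {φ : C(X, ℝ)} (hφ : ∀ x, 0 ≤ φ x) (h : single i j (1 + φ.toComplex) ∈ B) :
    single i j 1 ∈ B := by
  have h2 : ((1 + φ) * (1 + φ)).toComplex ∈ diagonalEntries B i hi := by
    have := mul_mem h (star_mem h)
    rw [star_single, single_mul_single] at this
    have e : ((1 + φ) * (1 + φ)).toComplex = (1 + φ.toComplex) * star (1 + φ.toComplex) := by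
      ext x
      simp
    rw [e]
    exact this
  let F : C(ℝ, ℝ) := ⟨fun t => (√(max 1 t))⁻¹, by
    refine Continuous.inv₀ (by fun_prop) fun t => ?_
    exact (Real.sqrt_pos.mpr (lt_max_of_lt_left one_pos)).ne'⟩
  have h3 : single i i (F.comp ((1 + φ) * (1 + φ))).toComplex ∈ B :=
    ContinuousMap.toComplex_comp_mem (isClosed_diagonalEntries hB i hi) h2 F
  have h4 := mul_mem h3 h
  rw [single_mul_single] at h4
  suffices e : (1 : C(X, ℂ)) = (F.comp ((1 + φ) * (1 + φ))).toComplex * (1 + φ.toComplex) by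
    rw [e]; exact h4
  ext x
  have hx := hφ x
  have e : F ((1 + φ x) * (1 + φ x)) = (1 + φ x)⁻¹ := by
    simp only [F, ContinuousMap.coe_mk]
    rw [max_eq_right (by nlinarith), Real.sqrt_mul_self (by linarith)]
  have hne : (1 + (φ x : ℂ)) ≠ 0 := by
    exact_mod_cast (by linarith : (0 : ℝ) < 1 + φ x).ne'
  simp only [ContinuousMap.one_apply, ContinuousMap.mul_apply, ContinuousMap.toComplex_apply,
    ContinuousMap.comp_apply, ContinuousMap.add_apply, e]
  push_cast
  exact (inv_mul_cancel₀ hne).symm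

end CStarMatrix

namespace CStarMatrix

variable {X : Type*} [TopologicalSpace X] [CompactSpace X]

/-- The entries above the diagonal of a matrix of real functions, to be made into the entries of a
hermitian matrix: those on the first superdiagonal are real and at least `1` (if `g ≥ 0`), the
others combine two of the given functions. -/
noncomputable def upperEntry {k : ℕ} (g : Fin k → Fin k → C(X, ℝ)) (i j : Fin k) : C(X, ℂ) :=
  if (i : ℕ) + 1 = j then 1 + (g i j).toComplex
  else (g i j).toComplex + Complex.I • (g j i).toComplex

/-- The hermitian matrix with the diagonal entries `g i i` and with `upperEntry g` above the
diagonal. It does not involve the functions `g (i + 1) i`. -/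
noncomputable def hermitianOfReal {k : ℕ} (g : Fin k → Fin k → C(X, ℝ)) :
    CStarMatrix (Fin k) (Fin k) C(X, ℂ) :=
  ofMatrix fun i j => if i = j then (g i i).toComplex else
    if i < j then upperEntry g i j else star (upperEntry g j i)

omit [CompactSpace X] in
lemma hermitianOfReal_apply {k : ℕ} (g : Fin k → Fin k → C(X, ℝ)) (i j : Fin k) :
    hermitianOfReal g i j = if i = j then (g i i).toComplex else
      if i < j then upperEntry g i j else star (upperEntry g j i) := rfl

omit [CompactSpace X] in
lemma star_hermitianOfReal {k : ℕ} (g : Fin k → Fin k → C(X, ℝ)) :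
    star (hermitianOfReal g) = hermitianOfReal g := by
  ext1 i j
  rw [star_apply]
  simp only [hermitianOfReal_apply]
  rcases lt_trichotomy i j with h | h | h
  · rw [if_neg h.ne', if_neg h.not_gt, if_neg h.ne, if_pos h, star_star]
  · subst h; simp
  · rw [if_neg h.ne, if_pos h, if_neg h.ne', if_neg h.not_gt]

/-- The functions on the diagonal of the diagonal matrix that completes `hermitianOfReal g`: they
are the functions `g (i + 1) i` and one further function `g'`. -/
def subdiagonal {k : ℕ} (g : Fin k → Fin k → C(X, ℝ)) (g' : C(X, ℝ)) (i : Fin k) : C(X, ℝ) :=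
  if h : (i : ℕ) + 1 < k then g ⟨i + 1, h⟩ i else g'

/-- If `k ^ 2 + 1` real functions with values in `[0, 1]` separate the points of `X`, then
`M_k(C(X))` is generated by one element. Its real part is a diagonal matrix whose diagonal
entries take values in disjoint intervals, so that it generates the diagonal matrix units; its
imaginary part has a positive superdiagonal, and so provides the other matrix units. The first uses
up `k` of the functions, the second the other `k ^ 2 - k + 1`. -/
theorem exists_generator {k : ℕ} (hk : 1 ≤ k) (g : Fin k → Fin k → C(X, ℝ)) (g' : C(X, ℝ))
    (hg : ∀ i j x, g i j x ∈ Set.Icc (0 : ℝ) 1) (hg' : ∀ x, g' x ∈ Set.Icc (0 : ℝ) 1)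
    (hsep : ∀ x y, (∀ i j, g i j x = g i j y) → g' x = g' y → x = y) :
    ∃ h : CStarMatrix (Fin k) (Fin k) C(X, ℂ),
      ∀ B : StarSubalgebra ℂ (CStarMatrix (Fin k) (Fin k) C(X, ℂ)),
        IsClosed (B : Set (CStarMatrix (Fin k) (Fin k) C(X, ℂ))) → h ∈ B → B = ⊤ := by
  obtain ⟨l, hl⟩ : ∃ l, l = subdiagonal g g' := ⟨_, rfl⟩
  have hl01 : ∀ i x, l i x ∈ Set.Icc (0 : ℝ) 1 := fun i x => by
    simp only [hl, subdiagonal]; split_ifs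
    · exact hg _ _ x
    · exact hg' x
  obtain ⟨a, ha⟩ : ∃ a : CStarMatrix (Fin k) (Fin k) C(X, ℂ), a = ofMatrix
    (Matrix.diagonal fun i : Fin k => (3 * (i : ℂ)) • (1 : C(X, ℂ)) + (l i).toComplex) := ⟨_, rfl⟩
  obtain ⟨b, hb⟩ : ∃ b, b = hermitianOfReal g := ⟨_, rfl⟩
  have hbs : star b = b := by rw [hb, star_hermitianOfReal]
  have has : star a = a := by
    rw [ha]
    refine (Matrix.diagonal_conjTranspose _).trans ?_
    change Matrix.diagonal _ = Matrix.diagonal _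
    congr 1
    ext i x
    simp
  refine ⟨a + Complex.I • b, fun B hB hh => ?_⟩
  have hh' := star_mem hh
  have haB : a ∈ B := by
    have : a = (1 / 2 : ℂ) • ((a + Complex.I • b) + star (a + Complex.I • b)) := by
      rw [star_add, star_smul, has, hbs, Complex.star_def, Complex.conj_I]
      module
    rw [this]
    exact B.smul_mem (add_mem hh hh') _
  have hbB : b ∈ B := by
    have : b = (-Complex.I / 2 : ℂ) • ((a + Complex.I • b) - star (a + Complex.I • b)) := by
      rw [star_add, star_smul, has, hbs, Complex.star_def, Complex.conj_I]
      rw [add_sub_add_left_eq_sub, neg_smul, sub_neg_eq_add, ← two_smul ℂ, smul_smul, smul_smul, mul_assoc]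
      have : -Complex.I / 2 * (2 * Complex.I) = 1 := by
        linear_combination (-1 : ℂ) * Complex.I_mul_I
      rw [this, one_smul]
    rw [this]
    exact B.smul_mem (sub_mem hh hh') _
  have h1 : ∀ i, single i i 1 ∈ B := single_one_mem hB hl01 (ha ▸ haB)
  have hent : ∀ c ∈ B, ∀ i j, single i j (c i j) ∈ B := fun c hc i j => by
    rw [← single_mul_mul_single]
    exact mul_mem (mul_mem (h1 i) hc) (h1 j)
  have hsucc : ∀ i j : Fin k, (i : ℕ) + 1 = j → single i j 1 ∈ B := fun i j hij => by
    refine single_one_mem_of_single_mem hB (h1 i) (φ := g i j) (fun x => (hg i j x).1) ?_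
    have := hent b hbB i j
    have hlt : i < j := Fin.lt_def.mpr (by omega)
    simpa only [hb, hermitianOfReal_apply, if_neg hlt.ne, if_pos hlt, upperEntry,
      if_pos hij] using this
  have h0 : ∀ (n : ℕ) (hn : n < k), single ⟨0, hk⟩ ⟨n, hn⟩ 1 ∈ B := by
    intro n
    induction n with
    | zero => intro hn; exact h1 _
    | succ n ih =>
      intro hn
      have := mul_mem (ih (by omega)) (hsucc ⟨n, by omega⟩ ⟨n + 1, hn⟩ rfl)
      rwa [single_mul_single, one_mul] at this
  have h0l : ∀ j : Fin k, single j ⟨0, hk⟩ 1 ∈ B := fun j => by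
    have := star_mem (h0 j j.2)
    rwa [star_single, star_one] at this
  -- all entries of `a` and `b` can be moved to the place `(0, 0)`
  have hmove : ∀ c ∈ B, ∀ i j, c i j ∈ diagonalEntries B ⟨0, hk⟩ (h1 _) := fun c hc i j => by
    have := mul_mem (mul_mem (h0 i i.2) (hent c hc i j)) (h0l j)
    rw [single_mul_single, single_mul_single, one_mul, mul_one] at this
    exact this
  have htop : diagonalEntries B ⟨0, hk⟩ (h1 _) = ⊤ := by
    rw [eq_top_iff, ← ContinuousMap.starSubalgebra_topologicalClosure_eq_top_of_separatesPoints
      (diagonalEntries B ⟨0, hk⟩ (h1 _)) ?_]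
    · exact StarSubalgebra.topologicalClosure_minimal le_rfl (isClosed_diagonalEntries hB _ _)
    intro x y hxy
    by_contra hcon
    have heq : ∀ c ∈ B, ∀ i j, c i j x = c i j y := fun c hc i j => by
      by_contra hne
      exact hcon ⟨_, ⟨c i j, hmove c hc i j, rfl⟩, hne⟩
    have hleq : ∀ i, l i x = l i y := fun i => by
      have := heq a haB i i
      simpa [ha] using this
    have hbeq : ∀ i j, i < j → upperEntry g i j x = upperEntry g i j y := fun i j hij => by
      have := heq b hbB i j
      simpa only [hb, hermitianOfReal_apply, if_neg hij.ne, if_pos hij] using this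
    have hup : ∀ i j, i < j → g i j x = g i j y ∧ g j i x = g j i y := fun i j hij => by
      have h := hbeq i j hij
      by_cases hs : (i : ℕ) + 1 = j
      · simp only [upperEntry, if_pos hs] at h
        refine ⟨by simpa using h, ?_⟩
        have hlt : (i : ℕ) + 1 < k := hs ▸ j.2
        have hj : (⟨i + 1, hlt⟩ : Fin k) = j := Fin.ext hs
        have := hleq i
        simpa only [hl, subdiagonal, dif_pos hlt, hj] using this
      · simp only [upperEntry, if_neg hs] at h
        have hre := congrArg Complex.re h
        have him := congrArg Complex.im h
        exact ⟨by simpa using hre, by simpa using him⟩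
    refine hxy (hsep x y (fun i j => ?_) ?_)
    · rcases lt_trichotomy i j with h | h | h
      · exact (hup i j h).1
      · subst h
        have := heq b hbB i i
        simpa [hb, hermitianOfReal_apply] using this
      · exact (hup j i h).2
    · have hlt : ¬ (k - 1 + 1 < k) := by omega
      have := hleq ⟨k - 1, by omega⟩
      simpa only [hl, subdiagonal, dif_neg hlt] using this
  rw [eq_top_iff]
  intro c _
  rw [eq_sum_single c]
  refine sum_mem fun i _ => sum_mem fun j _ => ?_
  have h : single ⟨0, hk⟩ ⟨0, hk⟩ (c i j) ∈ B := by
    have : c i j ∈ diagonalEntries B ⟨0, hk⟩ (h1 _) := by rw [htop]; trivial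
    exact this
  have := mul_mem (mul_mem (h0l i) h) (h0 j j.2)
  rwa [single_mul_single, single_mul_single, one_mul, mul_one] at this

end CStarMatrix

/-! ### Points in general position -/

section GeneralPosition

open MeasureTheory

variable {V : Type*} [NormedAddCommGroup V] [NormedSpace ℝ V] [FiniteDimensional ℝ V]

omit [FiniteDimensional ℝ V] in
/-- Fewer than `dim V + 1` points do not affinely span `V`. -/
lemma affineSpan_image_finset_ne_top {ι : Type*} (y : ι → V) (s : Finset ι)
    (hs : s.card ≤ Module.finrank ℝ V) : affineSpan ℝ (y '' s) ≠ ⊤ := by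
  classical
  intro h
  rcases s.eq_empty_or_nonempty with rfl | hne
  · rw [Finset.coe_empty, Set.image_empty, AffineSubspace.span_empty] at h
    exact AffineSubspace.bot_ne_top ℝ V V h
  · obtain ⟨n, hn⟩ : ∃ n, s.card = n + 1 := ⟨s.card - 1, by have := hne.card_pos; omega⟩
    have h1 := finrank_vectorSpan_image_finset_le ℝ y s hn
    have h2 : vectorSpan ℝ (y '' (s : Set ι)) = ⊤ := by
      rw [← direction_affineSpan, h, AffineSubspace.direction_top]
    rw [Finset.coe_image, h2, finrank_top] at h1
    omega

/-- Finitely many points can be moved by arbitrarily little to put them in general position: any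
`dim V + 1` of them become affinely independent. -/
lemma exists_general_position {ι : Type*} [Finite ι] (z : ι → V) {δ : ℝ} (hδ : 0 < δ) :
    ∃ y : ι → V, (∀ i, dist (y i) (z i) < δ) ∧
      ∀ (s : Finset ι), s.card ≤ Module.finrank ℝ V + 1 → ∀ w : ι → ℝ, ∑ i ∈ s, w i = 0 →
        ∑ i ∈ s, w i • y i = 0 → ∀ i ∈ s, w i = 0 := by
  classical
  have := Fintype.ofFinite ι
  suffices H : ∀ t : Finset ι, ∃ y : ι → V, (∀ i, dist (y i) (z i) < δ) ∧
      ∀ s ⊆ t, s.card ≤ Module.finrank ℝ V + 1 → ∀ w : ι → ℝ, ∑ i ∈ s, w i = 0 →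
        ∑ i ∈ s, w i • y i = 0 → ∀ i ∈ s, w i = 0 by
    obtain ⟨y, hy, h⟩ := H Finset.univ
    exact ⟨y, hy, fun s => h s (Finset.subset_univ s)⟩
  intro t
  induction t using Finset.induction_on with
  | empty =>
    refine ⟨z, fun i => by simpa using hδ, fun s hs _ w _ _ i hi => ?_⟩
    simpa using hs hi
  | insert a t ha ih =>
    obtain ⟨y, hy, h⟩ := ih
    borelize V
    -- the new point avoids finitely many proper affine subspaces, which are null sets
    obtain ⟨v, hv, hvn⟩ : ∃ v ∈ Metric.ball (z a) δ, ∀ s ∈ t.powerset,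
        s.card ≤ Module.finrank ℝ V → v ∉ affineSpan ℝ (y '' s) := by
      by_contra! hcon
      let μ : Measure V := Measure.addHaar
      let T : Finset (Finset ι) := t.powerset.filter fun s => s.card ≤ Module.finrank ℝ V
      have hsub : Metric.ball (z a) δ ⊆ ⋃ s ∈ (T : Set (Finset ι)),
          (affineSpan ℝ (y '' (s : Set ι)) : Set V) := fun v hv => by
        obtain ⟨s, hs, hc, hm⟩ := hcon v hv
        exact Set.mem_biUnion (Finset.mem_coe.mpr (Finset.mem_filter.mpr ⟨hs, hc⟩)) hm
      have hnull : μ (⋃ s ∈ (T : Set (Finset ι)),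
          (affineSpan ℝ (y '' (s : Set ι)) : Set V)) = 0 := by
        rw [measure_biUnion_null_iff (Finset.countable_toSet _)]
        intro s hs
        exact Measure.addHaar_affineSubspace μ _
          (affineSpan_image_finset_ne_top y s (Finset.mem_filter.mp (Finset.mem_coe.mp hs)).2)
      exact (Metric.measure_ball_pos μ (z a) hδ).ne' (measure_mono_null hsub hnull)
    refine ⟨Function.update y a v, fun i => ?_, fun s hs hcard w hw hwy => ?_⟩
    · by_cases hi : i = a
      · subst hi; simpa using hv
      · rw [Function.update_of_ne hi]; exact hy i
    -- the coefficients on `s.erase a` are governed by the points already chosen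
    have hst : s.erase a ⊆ t := by
      intro i hi
      have := hs (Finset.mem_of_mem_erase hi)
      exact (Finset.mem_insert.mp this).resolve_left (Finset.ne_of_mem_erase hi)
    have hupd : ∀ i ∈ s.erase a, Function.update y a v i = y i := fun i hi =>
      Function.update_of_ne (Finset.ne_of_mem_erase hi) _ _
    have hrest : w a = 0 ∨ a ∉ s → ∀ i ∈ s, w i = 0 := by
      intro hwa
      have e1 : ∑ i ∈ s.erase a, w i = 0 := by
        rcases hwa with hwa | hwa
        · rw [Finset.sum_erase s hwa, hw]
        · rw [Finset.erase_eq_of_notMem hwa, hw]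
      have e2 : ∑ i ∈ s.erase a, w i • y i = 0 := by
        have e3 : ∑ i ∈ s.erase a, w i • y i = ∑ i ∈ s.erase a, w i • Function.update y a v i :=
          Finset.sum_congr rfl fun i hi => by rw [hupd i hi]
        rw [e3, ← hwy]
        rcases hwa with hwa | hwa
        · exact Finset.sum_erase s (by rw [hwa, zero_smul])
        · rw [Finset.erase_eq_of_notMem hwa]
      have := h _ hst ((Finset.card_le_card (Finset.erase_subset a s)).trans hcard) w e1 e2
      intro i hi
      by_cases hia : i = a
      · subst hia; exact hwa.resolve_right (not_not.mpr hi)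
      · exact this i (Finset.mem_erase.mpr ⟨hia, hi⟩)
    by_cases has : a ∈ s
    swap
    · exact hrest (Or.inr has)
    by_cases hwa : w a = 0
    · exact hrest (Or.inl hwa)
    exfalso
    refine hvn (s.erase a) (Finset.mem_powerset.mpr hst) ?_ ?_
    · rw [Finset.card_erase_of_mem has]; omega
    · rw [← Finset.add_sum_erase s _ has] at hw hwy
      rw [Finset.sum_congr rfl fun i hi => by rw [hupd i hi], Function.update_self] at hwy
      have hc : ∑ i ∈ s.erase a, -(w a)⁻¹ * w i = 1 := by
        rw [← Finset.mul_sum, ← neg_eq_of_add_eq_zero_right hw]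
        field_simp
      have hv' : v = ∑ i ∈ s.erase a, (-(w a)⁻¹ * w i) • y i := by
        simp_rw [mul_smul]
        rw [← Finset.smul_sum, ← neg_eq_of_add_eq_zero_right hwy, smul_neg, neg_smul, neg_neg,
          smul_smul, inv_mul_cancel₀ hwa, one_smul]
      rw [hv', ← Finset.affineCombination_eq_linear_combination _ y _ hc]
      exact affineCombination_mem_affineSpan_image hc (s := s.erase a) (s' := (s.erase a : Finset ι))
        (fun i hi hn => absurd hi hn) y

end GeneralPosition

/-! ### The embedding theorem of Menger and Nöbeling -/

section MengerNobeling

variable {X : Type*} [MetricSpace X] [CompactSpace X]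
  {V : Type*} [NormedAddCommGroup V] [NormedSpace ℝ V] [FiniteDimensional ℝ V]

omit [NormedSpace ℝ V] [FiniteDimensional ℝ V] in
/-- The maps that identify no two points at distance at least `η` form an open set. -/
lemma isOpen_separating (η : ℝ) : IsOpen {f : C(X, V) | ∀ x y, η ≤ dist x y → f x ≠ f y} := by
  have hK : IsCompact {p : X × X | η ≤ dist p.1 p.2} :=
    (isClosed_le continuous_const continuous_dist).isCompact
  have hc : Continuous fun f : C(X, V) => f.comp ContinuousMap.fst - f.comp ContinuousMap.snd :=
    (ContinuousMap.continuous_precomp (ContinuousMap.fst : C(X × X, X))).sub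
      (ContinuousMap.continuous_precomp (ContinuousMap.snd : C(X × X, X)))
  convert (ContinuousMap.isOpen_setOfPred_mapsTo hK (isOpen_compl_singleton (x := (0 : V)))).preimage hc
    using 1
  ext f
  simp [Set.MapsTo, sub_eq_zero]

/-- The maps into a space of dimension at least `2 m + 1` that identify no two points at distance
at least `η` are dense if `dim X ≤ m`. To approximate a given map, take a fine cover of order at
most `m + 1`, and let the new map be the barycentric map `∑ ρ i • y i` of a subordinate
partition of unity `ρ` into points `y i` in general position. The points `x` and `x'` involve
at most `2 (m + 1)` of the `y i`, so their images agree only if `ρ i x = ρ i x'` for all `i`. -/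
lemma exists_separating_near {m : ℕ} (hdim : CoveringDimLE X m)
    (hV : 2 * m + 1 ≤ Module.finrank ℝ V) (f : C(X, V)) {ε η : ℝ} (hε : 0 < ε) (hη : 0 < η) :
    ∃ g : C(X, V), (∀ x y, η ≤ dist x y → g x ≠ g y) ∧ dist g f < ε := by
  classical
  obtain ⟨δ, hδ, hf⟩ := Metric.uniformContinuous_iff.mp
    (CompactSpace.uniformContinuous_of_continuous f.continuous) (ε / 4) (by positivity)
  obtain ⟨r, hr⟩ : ∃ r, r = min δ η / 2 := ⟨_, rfl⟩
  have hr0 : 0 < r := by rw [hr]; positivity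
  have hrδ : 2 * r ≤ δ := by rw [hr]; linarith [min_le_left δ η]
  have hrη : 2 * r ≤ η := by rw [hr]; linarith [min_le_right δ η]
  obtain ⟨c, -, hcf, hc⟩ := finite_cover_balls_of_compact (isCompact_univ (X := X)) hr0
  obtain ⟨W, hWf, hWo, hWu, hWs, hWc⟩ := hdim ((fun x => Metric.ball x r) '' c) (hcf.image _)
    (by rintro _ ⟨x, -, rfl⟩; exact Metric.isOpen_ball)
    (by rw [Set.sUnion_image]; exact Set.univ_subset_iff.mp hc)
  have hsmall : ∀ v ∈ W, ∀ x ∈ v, ∀ y ∈ v, dist x y < 2 * r := fun v hv x hx y hy => by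
    obtain ⟨_, ⟨z, -, rfl⟩, hsub⟩ := hWs v hv
    have h1 := Metric.mem_ball.mp (hsub hx)
    have h2 := Metric.mem_ball.mp (hsub hy)
    linarith [dist_triangle_right x y z]
  have : Finite W := hWf
  have := Fintype.ofFinite W
  obtain ⟨ρ, hρ⟩ := PartitionOfUnity.exists_isSubordinate_of_locallyFinite (isClosed_univ (X := X))
    (fun v : W => (v : Set X)) (fun v => hWo v v.2) (locallyFinite_of_finite _) (by
      rw [← Set.sUnion_eq_iUnion, hWu])
  have hρmem : ∀ (v : W) x, ρ v x ≠ 0 → x ∈ (v : Set X) := fun v x h =>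
    hρ v (subset_tsupport _ h)
  have hρsum : ∀ x, ∑ v, ρ v x = 1 := fun x => by
    rw [← finsum_eq_sum_of_fintype]; exact ρ.sum_eq_one (Set.mem_univ x)
  obtain ⟨z, hz⟩ : ∃ z : W → V, ∀ v : W, ∀ x ∈ (v : Set X), dist (z v) (f x) < ε / 4 := by
    refine ⟨fun v => if h : (v : Set X).Nonempty then f h.some else 0, fun v x hx => ?_⟩
    have hne : (v : Set X).Nonempty := ⟨x, hx⟩
    beta_reduce
    rw [dif_pos hne]
    exact hf ((hsmall v v.2 _ hne.some_mem _ hx).trans_le hrδ)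
  obtain ⟨y, hyz, hy⟩ := exists_general_position z (δ := ε / 4) (by positivity)
  let g : C(X, V) := ⟨fun x => ∑ v, ρ v x • y v, by fun_prop⟩
  refine ⟨g, fun x x' hxx' hg => ?_, ?_⟩
  · have hcardx : ∀ x, (Finset.univ.filter fun v : W => x ∈ (v : Set X)).card ≤ m + 1 := fun x => by
      have h1 := hWc x
      have h2 : {v ∈ W | x ∈ v} =
          Subtype.val '' ((Finset.univ.filter fun v : W => x ∈ (v : Set X)) : Set W) := by
        ext v; simp [and_comm]
      rw [h2, Subtype.val_injective.encard_image, Set.encard_coe_eq_coe_finsetCard] at h1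
      exact_mod_cast h1
    obtain ⟨s, hs⟩ : ∃ s, s = (Finset.univ.filter fun v : W => x ∈ (v : Set X)) ∪
      (Finset.univ.filter fun v : W => x' ∈ (v : Set X)) := ⟨_, rfl⟩
    have hscard : s.card ≤ Module.finrank ℝ V + 1 := by
      have := Finset.card_union_le (Finset.univ.filter fun v : W => x ∈ (v : Set X))
        (Finset.univ.filter fun v : W => x' ∈ (v : Set X))
      rw [← hs] at this
      have h1 := hcardx x
      have h2 := hcardx x'
      omega
    have hout : ∀ v, v ∉ s → ρ v x - ρ v x' = 0 := fun v hv => by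
      simp only [hs, Finset.mem_union, Finset.mem_filter, Finset.mem_univ, true_and, not_or] at hv
      have h1 : ρ v x = 0 := by_contra fun h => hv.1 (hρmem v x h)
      have h2 : ρ v x' = 0 := by_contra fun h => hv.2 (hρmem v x' h)
      rw [h1, h2, sub_zero]
    have e1 : ∑ v ∈ s, (ρ v x - ρ v x') = 0 := by
      rw [Finset.sum_subset (Finset.subset_univ s) fun v _ hv => hout v hv, Finset.sum_sub_distrib,
        hρsum, hρsum, sub_self]
    have e2 : ∑ v ∈ s, (ρ v x - ρ v x') • y v = 0 := by
      rw [Finset.sum_subset (Finset.subset_univ s) fun v _ hv => by rw [hout v hv, zero_smul]]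
      simp_rw [sub_smul]
      rw [Finset.sum_sub_distrib]
      exact sub_eq_zero.mpr hg
    have e3 := hy s hscard (fun v => ρ v x - ρ v x') e1 e2
    obtain ⟨v, hv⟩ : ∃ v, ρ v x ≠ 0 := by
      by_contra! h
      have := hρsum x
      simp [h] at this
    have hv' : ρ v x' ≠ 0 := by
      by_cases hvs : v ∈ s
      · rwa [← sub_eq_zero.mp (e3 v hvs)]
      · rwa [← sub_eq_zero.mp (hout v hvs)]
    have := hsmall v v.2 x (hρmem v x hv) x' (hρmem v x' hv')
    linarith
  · rw [ContinuousMap.dist_lt_iff hε]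
    intro x
    have hle : ∀ v, ‖ρ v x • (y v - f x)‖ ≤ ρ v x * (ε / 2) := fun v => by
      rw [norm_smul, Real.norm_eq_abs, abs_of_nonneg (ρ.nonneg v x)]
      by_cases h : ρ v x = 0
      · simp [h]
      · refine mul_le_mul_of_nonneg_left ?_ (ρ.nonneg v x)
        rw [← dist_eq_norm]
        have h1 := hyz v
        have h2 := hz v x (hρmem v x h)
        linarith [dist_triangle (y v) (z v) (f x)]
    have heq : g x - f x = ∑ v, ρ v x • (y v - f x) := by
      simp_rw [smul_sub]
      rw [Finset.sum_sub_distrib, ← Finset.sum_smul, hρsum, one_smul]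
      rfl
    rw [dist_eq_norm, heq]
    calc ‖∑ v, ρ v x • (y v - f x)‖ ≤ ∑ v, ρ v x * (ε / 2) :=
          (norm_sum_le _ _).trans (Finset.sum_le_sum fun v _ => hle v)
      _ = ε / 2 := by rw [← Finset.sum_mul, hρsum, one_mul]
      _ < ε := by linarith

/-- A compact metric space of covering dimension at most `m` embeds into any real vector space of
dimension at least `2 m + 1`: by Baire's theorem, some map identifies no two distinct points. -/
theorem CoveringDimLE.exists_injective {m : ℕ} (hdim : CoveringDimLE X m)
    (hV : 2 * m + 1 ≤ Module.finrank ℝ V) : ∃ f : C(X, V), Function.Injective f := by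
  have : CompleteSpace V := FiniteDimensional.complete ℝ V
  have hdense : Dense (⋂ n : ℕ, {f : C(X, V) | ∀ x y, 1 / ((n : ℝ) + 1) ≤ dist x y → f x ≠ f y}) :=
    dense_iInter_of_isOpen (fun n => isOpen_separating _) fun n => by
      rw [Metric.dense_iff]
      intro f ε hε
      obtain ⟨g, hg, hgf⟩ := exists_separating_near hdim hV f hε
        (Nat.one_div_pos_of_nat (α := ℝ) (n := n))
      exact ⟨g, hgf, hg⟩
  obtain ⟨f, hf⟩ := hdense.nonempty
  refine ⟨f, fun x y hxy => ?_⟩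
  by_contra hne
  obtain ⟨n, hn⟩ := exists_nat_one_div_lt (dist_pos.mpr hne)
  exact Set.mem_iInter.mp hf n x y hn.le hxy

end MengerNobeling

/-! ### From `M_k(C(X))` to `M_{3k}(C(X))` -/

namespace CStarMatrix

section Block

open Matrix

variable {p n : Type*} {R : Type*} [CommRing R]

/-- The `3 × 3` block matrix with the only nonzero block `c`, in the place `(a, b)`. -/
def block (e : Fin 3 × p ≃ n) (a b : Fin 3) (c : CStarMatrix p p R) : CStarMatrix n n R :=
  ofMatrix ((kroneckerMap (· * ·) (Matrix.single a b (1 : R)) (ofMatrix.symm c)).submatrix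
    e.symm e.symm)

variable (e : Fin 3 × p ≃ n)

lemma block_apply (a b : Fin 3) (c : CStarMatrix p p R) (i j : n) : block e a b c i j =
    if a = (e.symm i).1 ∧ b = (e.symm j).1 then c (e.symm i).2 (e.symm j).2 else 0 := by
  change Matrix.single a b (1 : R) _ _ * c _ _ = _
  rw [Matrix.single_apply]
  split_ifs <;> simp

lemma block_mul_block [Fintype p] [Fintype n] (a b b' d : Fin 3) (c c' : CStarMatrix p p R) :
    block e a b c * block e b' d c' = if b = b' then block e a d (c * c') else 0 := by
  refine (Matrix.submatrix_mul_equiv (kroneckerMap (· * ·) (Matrix.single a b (1 : R)) (ofMatrix.symm c))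
    (kroneckerMap (· * ·) (Matrix.single b' d (1 : R)) (ofMatrix.symm c')) e.symm e.symm e.symm).trans ?_
  have := Matrix.mul_kronecker_mul (Matrix.single a b (1 : R)) (Matrix.single b' d (1 : R))
    (ofMatrix.symm c) (ofMatrix.symm c')
  rw [← this]
  split_ifs with h
  · subst h
    rw [Matrix.single_mul_single_same, one_mul]
    rfl
  · rw [Matrix.single_mul_single_of_ne _ _ _ _ h, Matrix.zero_kronecker]
    rfl

lemma block_add (a b : Fin 3) (c c' : CStarMatrix p p R) :
    block e a b (c + c') = block e a b c + block e a b c' := by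
  ext i j
  simp only [block_apply, add_apply]
  split_ifs <;> simp

lemma star_block [StarRing R] (a b : Fin 3) (c : CStarMatrix p p R) :
    star (block e a b c) = block e b a (star c) := by
  ext i j
  simp only [star_apply, block_apply, and_comm (a := a = _)]
  split_ifs <;> simp

lemma sum_block_one [DecidableEq p] [DecidableEq n] : ∑ a, block e a a (1 : CStarMatrix p p R) = 1 := by
  ext i j
  have : (∑ a, block e a a (1 : CStarMatrix p p R)) i j
      = ∑ a, block e a a (1 : CStarMatrix p p R) i j := Matrix.sum_apply i j _ _
  rw [this, one_apply]
  simp only [block_apply, one_apply, ← ite_and]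
  by_cases h : i = j
  · subst h; simp
  · rw [if_neg h]
    refine Finset.sum_eq_zero fun a _ => if_neg fun ⟨⟨h1, h2⟩, h3⟩ => h ?_
    exact e.symm.injective (Prod.ext (h1.symm.trans h2) h3)

lemma eq_sum_block (x : CStarMatrix n n R) :
    x = ∑ a, ∑ b, block e a b (ofMatrix fun i j => x (e (a, i)) (e (b, j))) := by
  ext i j
  have : (∑ a, ∑ b, block e a b (ofMatrix fun i j => x (e (a, i)) (e (b, j)))) i j
      = ∑ a, ∑ b, block e a b (ofMatrix fun i j => x (e (a, i)) (e (b, j))) i j :=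
    (Matrix.sum_apply i j _ _).trans (Finset.sum_congr rfl fun a _ => Matrix.sum_apply i j _ _)
  rw [this, Finset.sum_eq_single (e.symm i).1, Finset.sum_eq_single (e.symm j).1]
  · rw [block_apply, if_pos ⟨rfl, rfl⟩]
    change x i j = x (e (e.symm i)) (e (e.symm j))
    simp
  · intro b _ hb
    rw [block_apply, if_neg fun h => hb h.2]
  · simp
  · intro a _ ha
    exact Finset.sum_eq_zero fun b _ => by rw [block_apply, if_neg fun h => ha h.1]
  · simp

end Block

variable {X : Type*} [TopologicalSpace X] [CompactSpace X]
  {p n : Type*}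

lemma continuous_block (e : Fin 3 × p ≃ n) (a b : Fin 3) :
    Continuous (block e a b : CStarMatrix p p C(X, ℂ) → CStarMatrix n n C(X, ℂ)) := by
  refine continuous_pi fun i => continuous_pi fun j => ?_
  simp only [block_apply]
  split_ifs
  · exact (continuous_apply (e.symm j).2).comp (continuous_apply (e.symm i).2)
  · exact continuous_const

/-- If `M_p(C(X))` has one generator, then the algebra of `3 × 3` block matrices with blocks in it
is generated by three almost orthogonal projections. -/
theorem isGeneratedByAlmostOrthogonalProjections_of_generator [Fintype p] [Fintype n]
    [DecidableEq p] [DecidableEq n] (e : Fin 3 × p ≃ n)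
    {h : CStarMatrix p p C(X, ℂ)}
    (hh : ∀ B : StarSubalgebra ℂ (CStarMatrix p p C(X, ℂ)),
      IsClosed (B : Set (CStarMatrix p p C(X, ℂ))) → h ∈ B → B = ⊤) :
    IsGeneratedByAlmostOrthogonalProjections (CStarMatrix n n C(X, ℂ)) 3 := by
  refine isGeneratedByAlmostOrthogonalProjections_of_matrixUnits
    (E := fun a b => block e a b 1) (H := block e 0 2 h) (fun a b c d => ?_) (fun a b => ?_)
    (sum_block_one e) ?_ ?_ fun B hB hE hH => ?_
  · rw [block_mul_block, one_mul]
  · rw [star_block, star_one]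
  · rw [block_mul_block, if_pos rfl, one_mul]
  · rw [block_mul_block, if_pos rfl, mul_one]
  let S : StarSubalgebra ℂ (CStarMatrix p p C(X, ℂ)) :=
    { carrier := {c | block e 0 0 c ∈ B}
      mul_mem' := fun {c d} hc hd => by
        have := mul_mem (show block e 0 0 c ∈ B from hc) (show block e 0 0 d ∈ B from hd)
        rwa [block_mul_block, if_pos rfl] at this
      add_mem' := fun {c d} hc hd => by
        have := add_mem (show block e 0 0 c ∈ B from hc) (show block e 0 0 d ∈ B from hd)
        rwa [← block_add] at this
      algebraMap_mem' := fun r => by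
        have := B.smul_mem (hE 0 0) r
        have e' : r • block e 0 0 (1 : CStarMatrix p p C(X, ℂ))
            = block e 0 0 (algebraMap ℂ _ r) := by
          ext1 i j
          rw [Algebra.algebraMap_eq_smul_one, smul_apply, block_apply, block_apply]
          split_ifs <;> simp
        rwa [e'] at this
      star_mem' := fun {c} hc => by
        have := star_mem (show block e 0 0 c ∈ B from hc)
        rwa [star_block] at this }
  have hS : S = ⊤ := by
    refine hh S (hB.preimage (continuous_block e 0 0)) ?_
    have := mul_mem hH (hE 2 0)
    rw [block_mul_block, if_pos rfl, mul_one] at this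
    exact this
  have hall : ∀ a b c, block e a b c ∈ B := fun a b c => by
    have hc : block e 0 0 c ∈ B := by
      have : c ∈ S := by rw [hS]; trivial
      exact this
    have := mul_mem (mul_mem (hE a 0) hc) (hE 0 b)
    rwa [block_mul_block, if_pos rfl, block_mul_block, if_pos rfl, one_mul, mul_one] at this
  rw [eq_top_iff]
  intro x _
  rw [eq_sum_block e x]
  exact sum_mem fun a _ => sum_mem fun b _ => hall a b _

end CStarMatrix

/-- If at most `k ^ 2 + 1` real functions separate the points of `X`, then `M_{3k}(C(X))` is
generated by three almost orthogonal projections. -/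
theorem pgen_le_three_of_separating {X : Type*} [TopologicalSpace X] [CompactSpace X] {k : ℕ}
    (hk : 1 ≤ k) {ι : Type*} [Fintype ι] (hι : Fintype.card ι ≤ k ^ 2 + 1) (f : ι → C(X, ℝ))
    (hf : ∀ x y, (∀ i, f i x = f i y) → x = y) :
    Pgen (CStarMatrix (Fin (3 * k)) (Fin (3 * k)) C(X, ℂ)) ≤ 3 := by
  obtain ⟨σ⟩ : Nonempty (ι ↪ Option (Fin k × Fin k)) :=
    Function.Embedding.nonempty_of_card_le (by simpa [sq] using hι)
  let φ : C(ℝ, ℝ) := ⟨Real.sigmoid, by fun_prop⟩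
  let F : Option (Fin k × Fin k) → C(X, ℝ) := fun o => φ.comp (Function.extend σ f 0 o)
  have hF : ∀ o x, F o x ∈ Set.Icc (0 : ℝ) 1 := fun o x =>
    ⟨Real.sigmoid_nonneg _, Real.sigmoid_le_one _⟩
  obtain ⟨h, hh⟩ := CStarMatrix.exists_generator hk (fun i j => F (some (i, j))) (F none)
    (fun i j => hF _) (hF _) fun x y h1 h2 => hf x y fun i => by
      have hall : ∀ o, F o x = F o y := fun o => by
        rcases o with _ | ⟨a, b⟩
        exacts [h2, h1 a b]
      have := Real.sigmoid_strictMono.injective (hall (σ i))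
      rwa [σ.injective.extend_apply] at this
  exact sInf_le ⟨3, rfl, by norm_num,
    CStarMatrix.isGeneratedByAlmostOrthogonalProjections_of_generator finProdFinEquiv hh⟩

lemma one_le_leastNatGE_and_le (x : ℝ) : 1 ≤ leastNatGE x ∧ x ≤ leastNatGE x := by
  obtain ⟨n, hn⟩ := exists_nat_ge x
  have hne : {n : ℕ | 1 ≤ n ∧ x ≤ n}.Nonempty :=
    ⟨n + 1, by omega, by push_cast; linarith⟩
  exact Nat.sInf_mem hne

theorem corollary3p5 (X : Type*) [MetricSpace X] [CompactSpace X] (m : ℕ)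
    (hdim : CoveringDimLE X m) :
    (1 ≤ m → (∃ f : X → EuclideanSpace ℂ (Fin m), Topology.IsEmbedding f) →
      ∀ k : ℕ, k = leastNatGE (Real.sqrt (2 * (m : ℝ) - 1)) →
        Pgen (CStarMatrix (Fin (3 * k)) (Fin (3 * k)) C(X, ℂ)) ≤ 3) ∧
    (∀ s : ℕ, s = leastNatGE (Real.sqrt (2 * (m : ℝ))) →
        Pgen (CStarMatrix (Fin (3 * s)) (Fin (3 * s)) C(X, ℂ)) ≤ 3) := by
  refine ⟨fun _ ⟨f, hf⟩ k hk => ?_, fun s hs => ?_⟩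
  · obtain ⟨h1, h2⟩ := one_le_leastNatGE_and_le (√(2 * (m : ℝ) - 1))
    rw [← hk] at h1 h2
    have hfc := hf.continuous
    have hcard : 2 * m ≤ k ^ 2 + 1 := by
      have := (Real.sqrt_le_left (by positivity)).mp h2
      have h' : (2 * m : ℝ) ≤ k ^ 2 + 1 := by linarith
      exact_mod_cast h'
    -- the real and the imaginary parts of the `m` complex coordinates
    refine pgen_le_three_of_separating h1 (ι := Fin m ⊕ Fin m)
      (by rw [Fintype.card_sum, Fintype.card_fin]; omega)
      (Sum.elim (fun i => ⟨fun x => (f x i).re, by fun_prop⟩)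
        (fun i => ⟨fun x => (f x i).im, by fun_prop⟩)) fun x y hxy => hf.injective ?_
    ext i
    exact Complex.ext (hxy (Sum.inl i)) (hxy (Sum.inr i))
  · obtain ⟨h1, h2⟩ := one_le_leastNatGE_and_le (√(2 * (m : ℝ)))
    rw [← hs] at h1 h2
    have hcard : 2 * m ≤ s ^ 2 := by
      have h' := (Real.sqrt_le_left (by positivity)).mp h2
      exact_mod_cast h'
    obtain ⟨f, hf⟩ := hdim.exists_injective (V := EuclideanSpace ℝ (Fin (2 * m + 1))) (by simp)
    refine pgen_le_three_of_separating h1 (ι := Fin (2 * m + 1))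
      (by rw [Fintype.card_fin]; omega) (fun i => ⟨fun x => f x i, by fun_prop⟩)
      fun x y hxy => hf ?_
    ext i
    exact hxy i
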